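/- Call a total function $f:\omega\to\omega$ \emph{approximable from above} if there is a total computable $g:\omega^2\to\omega$ with $g(x,s+1)\le g(x,s)$ for all $x,s$ and $f(x)=\lim_s g(x,s)$ for all $x$. For total functions $\alpha,\beta:\omega\to\omega$, write $\alpha\le_1\beta$ if $\alpha=\beta\circ h$ for some injective total computable $h$, and $\alpha\equiv_1\beta$ if $\alpha\le_1\beta$ and $\beta\le_1\alpha$; write $\alpha\le_{k\text{-}\mathrm{btt}}\beta$ if there are a computable map $x\mapsto D_x$ assigning to each $x$ (an explicit list of the elements of) a finite set $D_x\subseteq\omega$ with $|D_x|\le k$, and a total computable $g$, such that $\alpha(x)=g(x,\beta\restriction D_x)$ for all $x$. A graph (symmetric and irreflexive) with domain $\omega$ is \emph{computable} if its edge relation is decidable. The distance function $d_H$ of a connected graph $H$ with domain $\omega$ assigns to each pair $(x,y)$ the length of a shortest path from $x$ to $y$; it is regarded as a function $\omega\to\omega$ through a computable bijection $\omega\times\omega\to\omega$. \textbf{Theorem.} For every function $f:\omega\to\omega$ that is approximable from above there is a computable connected graph $G$ with domain $\omega$, with distance function $d$, such that the Turing degree spectrum of $d$, i.e. $$\{\deg(d_H)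 : H \text{ a computable graph with domain } \omega \text{ isomorphic to } G\},$$ equals $\{\deg(f)\}$. Moreover, for every computable graph $H$ with domain $\omega$ that is isomorphic to $G$, $$d_H\equiv_1 d\le_{2\text{-}\mathrm{btt}} f\le_{1\text{-}\mathrm{btt}} d_H .$$ -/

import Mathlib

/-- A total function `f : ω → ω` is approximable from above if it is the limit of a total
computable binary function `g` with `g x (s + 1) ≤ g x s` for all `x` and `s`
(limits in `ω` are taken in the discrete topology, so `g x s = f x` for all large `s`). -/
def ApproximableFromAbove (f : ℕ → ℕ) : Prop :=
  ∃ g : ℕ → ℕ → ℕ, Computable₂ g ∧ (∀ x s, g x (s + 1) ≤ g x s) ∧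
    ∀ x, ∀ᶠ s in Filter.atTop, g x s = f x

/-- `φ` is 1-reducible to `ψ`: `φ = ψ ∘ g` for some injective total computable `g`. -/
def FunOneReducible (φ ψ : ℕ → ℕ) : Prop :=
  ∃ g : ℕ → ℕ, Computable g ∧ Function.Injective g ∧ φ = ψ ∘ g

/-- `φ` and `ψ` are 1-equivalent. -/
def FunOneEquiv (φ ψ : ℕ → ℕ) : Prop :=
  FunOneReducible φ ψ ∧ FunOneReducible ψ φ

/-- `α` is bounded truth-table reducible to `β` with norm `k`. From the input `x` alone one
computes an explicit finite list `D x` of at most `k` queries, and a total computable `g`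
turns `x` and the oracle's answers to these queries into the value `α x`. The
restriction of `β` to `D x` is given to `g` as the list of the values of `β` along `D x`
(the arguments themselves are computable from `x`). -/
def BTTReducible (k : ℕ) (α β : ℕ → ℕ) : Prop :=
  ∃ (D : ℕ → List ℕ) (g : ℕ → List ℕ → ℕ), Computable D ∧ Computable₂ g ∧
    (∀ x, (D x).length ≤ k) ∧ ∀ x, α x = g x ((D x).map β)

/-- The Turing degree of a total function. -/
def turingDeg (f : ℕ → ℕ) : TuringDegree :=
  toAntisymmetrization TuringReducible (f : ℕ →. ℕ)

/-- A (symmetric, irreflexive) graph with domain `ω` is computable if its edge relation is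
decidable by an algorithm. -/
def ComputableGraph (G : SimpleGraph ℕ) : Prop :=
  ComputablePred fun p : ℕ × ℕ => G.Adj p.1 p.2

/-- The distance function of a graph with domain `ω`, as a function on `ω` through the standard
computable bijection `ω × ω ≃ ω`. It is used for connected graphs only. -/
noncomputable def distFun (G : SimpleGraph ℕ) : ℕ → ℕ :=
  fun n => G.dist n.unpair.1 n.unpair.2

/-- The Turing degree spectrum of the distance function of `G`: the set of the Turing degrees
of the distance functions of all computable graphs isomorphic to `G`. An isomorphic copy of a
graph with domain `ω` is infinite, so that its domain, an initial segment of `ω`, is `ω`. -/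
def distSpectrum (G : SimpleGraph ℕ) : Set TuringDegree :=
  {a | ∃ H : SimpleGraph ℕ, ComputableGraph H ∧ Nonempty (G ≃g H) ∧ a = turingDeg (distFun H)}

/-! Let `g` be a nonincreasing approximation of `f`, so that `f x ≤ g x 0`. The graph is a comb: a
spine of roots carries infinite teeth, a hub is joined to every root, and as the approximation to `f
x` drops, paths of length 2 to the hub are attached to tooth `x`, by stage `s` at all heights from 1
to `g x 0 - g x s + 1`. Whether a given height ever gets a shortcut is only semidecidable, but the
code of a shortcut contains the stage at which it appears, so vertices and edges are decidable.

In the limit the shortcuts reach height `g x 0 - f x + 1`, so the vertex of height `g x 0 + 1` has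
distance `f x + 2` to the hub: one query to the distance gives `f x`. Conversely, a shortest path
either avoids the hub, and then its length does not depend on `f`, or splits at the hub into two
parts whose lengths need one value of `f` each (`comb_dist`). Hence two queries to `f` suffice.

All of this transfers to every computable copy because the comb is computably categorical
(`comb_iso_computable`): once the images of the hub and of two roots are known, local adjacency
conditions determine the images of all other vertices. Computable isomorphisms make the distance
functions 1-equivalent (`funOneReducible_distFun`), so only one degree occurs. -/

/-! ### Computability lemmas -/

section Computability

variable {α β σ : Type*} [Primcodable α] [Primcodable β] [Primcodable σ]

theorem ComputablePred.comp {p : β → Prop} (hp : ComputablePred p) {h : α → β}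
    (hh : Computable h) : ComputablePred fun a => p (h a) := by
  obtain ⟨_, hd⟩ := hp
  exact ⟨inferInstance, hd.comp hh⟩

theorem ComputablePred.and {p q : α → Prop} (hp : ComputablePred p) (hq : ComputablePred q) :
    ComputablePred fun a => p a ∧ q a := by
  classical
  exact Computable.computablePred
    ((Primrec.and.to_comp.comp hp.decide hq.decide).of_eq fun a => by simp)

theorem ComputablePred.or {p q : α → Prop} (hp : ComputablePred p) (hq : ComputablePred q) :
    ComputablePred fun a => p a ∨ q a := by
  classical
  exact Computable.computablePred
    ((Primrec.or.to_comp.comp hp.decide hq.decide).of_eq fun a => by simp)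

theorem ComputablePred.eq {h k : α → σ} (hh : Computable h) (hk : Computable k) :
    ComputablePred fun a => h a = k a := by
  classical
  exact Computable.computablePred (Primrec.eq.decide.to_comp.comp hh hk)

theorem ComputablePred.natLE {h k : α → ℕ} (hh : Computable h) (hk : Computable k) :
    ComputablePred fun a => h a ≤ k a :=
  Computable.computablePred (Primrec.nat_le.decide.to_comp.comp hh hk)

theorem Computable.natAdd {h k : α → ℕ} (hh : Computable h) (hk : Computable k) :
    Computable fun a => h a + k a :=
  Primrec.nat_add.to_comp.comp hh hk

theorem Computable.natSub {h k : α → ℕ} (hh : Computable h) (hk : Computable k) :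
    Computable fun a => h a - k a :=
  Primrec.nat_sub.to_comp.comp hh hk

/-- A total function whose graph is decidable is computable. -/
theorem Computable.of_computablePred_graph {u : α → ℕ} {P : α × ℕ → Prop}
    (hP : ComputablePred P) (h : ∀ a n, P (a, n) ↔ n = u a) : Computable u := by
  classical
  have hex : ∀ a, ∃ n, P (a, n) := fun a => ⟨u a, (h a _).2 rfl⟩
  refine (Computable.find (P := fun a n => P (a, n)) hP hex).of_eq fun a => ?_
  exact (h a _).1 (Nat.find_spec (hex a))

/-- A sequence each of whose terms is determined by the two previous ones through a decidable
condition is computable. -/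
theorem Computable₂.of_step {u : α → ℕ → ℕ} {P : (ℕ × ℕ) × ℕ → Prop} (hP : ComputablePred P)
    (h0 : Computable fun a => u a 0) (h1 : Computable fun a => u a 1)
    (hstep : ∀ a n y, P ((u a n, u a (n + 1)), y) ↔ y = u a (n + 2)) : Computable₂ u := by
  classical
  have hfind : Partrec fun c : ℕ × ℕ => Nat.rfind fun y => Part.some (decide (P (c, y))) :=
    Partrec.rfind hP.decide.partrec
  have hs : Partrec fun c : ℕ × ℕ =>
      (Nat.rfind fun y => Part.some (decide (P (c, y)))).map fun y => (c.2, y) :=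
    hfind.map ((Computable.snd.comp Computable.fst).pair Computable.snd).to₂
  -- The state is a pair of consecutive terms. The search may diverge on other pairs, so the
  -- recursion is partial at first; `key` shows that it converges on the pairs that occur.
  have hrec : Partrec fun p : α × ℕ =>
      (Nat.rec (Part.some (u p.1 0, u p.1 1))
        (fun _ IH => IH.bind fun c : ℕ × ℕ =>
          (Nat.rfind fun y => Part.some (decide (P (c, y)))).map fun y => (c.2, y)) p.2 :
        Part (ℕ × ℕ)) :=
    Partrec.nat_rec (f := fun p : α × ℕ => p.2)
      (g := fun p => Part.some (u p.1 0, u p.1 1))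
      (h := fun (_ : α × ℕ) (q : ℕ × ℕ × ℕ) =>
        (Nat.rfind fun y => Part.some (decide (P (q.2, y)))).map fun y => (q.2.2, y))
      Computable.snd
      (((h0.comp Computable.fst).pair (h1.comp Computable.fst)).partrec)
      (hs.comp (Computable.snd.comp Computable.snd)).to₂
  have key : ∀ a n, (Nat.rec (Part.some (u a 0, u a 1))
        (fun _ IH => IH.bind fun c : ℕ × ℕ =>
          (Nat.rfind fun y => Part.some (decide (P (c, y)))).map fun y => (c.2, y)) n :
        Part (ℕ × ℕ)) = Part.some (u a n, u a (n + 1)) := by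
    intro a n
    induction n with
    | zero => rfl
    | succ n ih =>
      have : (Nat.rfind fun y => Part.some (decide (P ((u a n, u a (n + 1)), y)))) =
          Part.some (u a (n + 2)) := by
        refine Part.eq_some_iff.2 (Nat.mem_rfind.2
          ⟨by simpa using (hstep a n _).2 rfl, fun {m} hm => ?_⟩)
        have : ¬ P ((u a n, u a (n + 1)), m) := fun h => hm.ne ((hstep a n m).1 h)
        simpa using this
      dsimp only
      rw [ih, Part.bind_some, this, Part.map_some]
  have hU : Computable fun p : α × ℕ => (u p.1 p.2, u p.1 (p.2 + 1)) :=
    hrec.of_eq fun p => key p.1 p.2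
  exact (Computable.fst.comp hU).of_eq fun _ => rfl

/-- An infinite decidable set has a computable enumeration without repetitions. -/
theorem ComputablePred.exists_enum {V : Type*} [Denumerable V] {p : V → Prop}
    (hp : ComputablePred p) (hinf : {v | p v}.Infinite) :
    ∃ e : ℕ → V, Computable e ∧ Function.Injective e ∧ ∀ v, p v ↔ ∃ n, e n = v := by
  classical
  let P : ℕ → Prop := fun n => p (Denumerable.ofNat V n)
  have hP : ComputablePred P := hp.comp (Computable.ofNat V)
  have hPinf : {n | P n}.Infinite := by
    have : {n | P n} = Encodable.encode '' {v | p v} := by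
      ext n
      constructor
      · intro h
        exact ⟨_, h, Denumerable.encode_ofNat n⟩
      · rintro ⟨v, hv, rfl⟩
        change p (Denumerable.ofNat V (Encodable.encode v))
        rwa [Denumerable.ofNat_encode]
    rw [this]
    exact hinf.image Encodable.encode_injective.injOn
  have hcount : Computable (Nat.count P) := by
    have : Computable fun n : ℕ => (Nat.rec 0
        (fun y IH => IH + cond (decide (P y)) 1 0) n : ℕ) :=
      Computable.nat_rec (f := fun n : ℕ => n) (g := fun _ => 0)
        (h := fun _ q => q.2 + cond (decide (P q.1)) 1 0) Computable.id (Computable.const 0)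
        (Computable.natAdd (Computable.snd.comp Computable.snd)
          (Computable.cond (hP.decide.comp (Computable.fst.comp Computable.snd))
            (Computable.const 1) (Computable.const 0))).to₂
    refine this.of_eq fun n => ?_
    induction n with
    | zero => simp
    | succ n ih => rw [Nat.count_succ, ← ih]; by_cases h : P n <;> simp [h]
  -- The `n`-th element is the unique member with exactly `n` members below it, which is decidable
  -- through `Nat.count`.
  have hnth : Computable (Nat.nth P) := by
    refine Computable.of_computablePred_graph (P := fun q => P q.2 ∧ Nat.count P q.2 = q.1)
      ((hP.comp Computable.snd).and
        (ComputablePred.eq (hcount.comp Computable.snd) Computable.fst)) fun n m => ?_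
    constructor
    · rintro ⟨h, hm⟩
      exact ((congrArg (Nat.nth P) hm).symm.trans (Nat.nth_count h)).symm
    · rintro rfl
      exact ⟨Nat.nth_mem_of_infinite hPinf n, Nat.count_nth_of_infinite hPinf n⟩
  refine ⟨fun n => Denumerable.ofNat V (Nat.nth P n), (Computable.ofNat V).comp hnth, ?_, ?_⟩
  · intro m n h
    apply Nat.nth_injective hPinf
    have := congrArg Encodable.encode h
    simpa using this
  · intro v
    constructor
    · intro hv
      refine ⟨Nat.count P (Encodable.encode v), ?_⟩
      have : P (Encodable.encode v) := by simpa [P] using hv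
      simp [Nat.nth_count this]
    · rintro ⟨n, rfl⟩
      exact Nat.nth_mem_of_infinite hPinf n

/-- The inverse of a computable bijection is computable. -/
theorem Computable.equiv_symm {h : ℕ ≃ ℕ} (hh : Computable h) : Computable h.symm :=
  Computable.of_computablePred_graph (P := fun q => h q.2 = q.1)
    (ComputablePred.eq (hh.comp Computable.snd) Computable.fst)
    fun a n => (h.eq_symm_apply (x := a) (y := n)).symm

end Computability

/-! ### Reductions that ask two queries -/

/-- The data are those of `bttReducible_two`, so one formula for the distance serves both
reductions. Single queries are covered by taking `a = b`. -/
theorem turingReducible_of_two_queries {φ ψ a b : ℕ → ℕ} {F : ℕ × ℕ × ℕ → ℕ}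
    (ha : Computable a) (hb : Computable b) (hF : Computable F)
    (h : ∀ x, φ x = F (x, ψ (a x), ψ (b x))) : TuringReducible (φ : ℕ →. ℕ) (ψ : ℕ →. ℕ) := by
  have hq : ∀ {c : ℕ → ℕ}, Computable c →
      Nat.RecursiveIn {(ψ : ℕ →. ℕ)} fun x => Part.some (ψ (c x)) := fun {c} hc =>
    (Nat.RecursiveIn.comp (f := (ψ : ℕ →. ℕ)) (.oracle _ (Set.mem_singleton _))
      (Partrec.nat_iff.1 hc.partrec).recursiveIn).of_eq fun x => Part.bind_some _ _
  have hid : Nat.RecursiveIn {(ψ : ℕ →. ℕ)} fun x => Part.some x :=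
    (Partrec.nat_iff.1 (Computable.id (α := ℕ)).partrec).recursiveIn
  have hF' : Computable fun n : ℕ => F (n.unpair.1, n.unpair.2.unpair) :=
    hF.comp ((Computable.fst.comp Computable.unpair).pair
      (Computable.unpair.comp (Computable.snd.comp Computable.unpair)))
  refine RecursiveIn.iff_nat.2 ((Nat.RecursiveIn.comp
    (Partrec.nat_iff.1 hF'.partrec).recursiveIn (hid.pair ((hq ha).pair (hq hb)))).of_eq
    fun x => ?_)
  rw [show (Nat.pair <$> Part.some x <*> (Nat.pair <$> Part.some (ψ (a x)) <*>
      Part.some (ψ (b x))) : Part ℕ) = Part.some (Nat.pair x (Nat.pair (ψ (a x)) (ψ (b x)))) by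
    simp [Seq.seq]]
  refine (Part.bind_some _ _).trans ?_
  simp [h]

theorem bttReducible_two {φ ψ a b : ℕ → ℕ} {F : ℕ × ℕ × ℕ → ℕ}
    (ha : Computable a) (hb : Computable b) (hF : Computable F)
    (h : ∀ x, φ x = F (x, ψ (a x), ψ (b x))) : BTTReducible 2 φ ψ := by
  refine ⟨fun x => [a x, b x], fun x l => F (x, l.getD 0 0, l.getD 1 0), ?_, ?_, ?_, ?_⟩
  · exact Computable.list_cons.comp ha (Computable.list_cons.comp hb (Computable.const []))
  · have hg : ∀ i, Computable fun p : ℕ × List ℕ => p.2.getD i 0 := fun i =>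
      (Primrec.list_getD 0).to_comp.comp Computable.snd (Computable.const i)
    exact (hF.comp (Computable.fst.pair ((hg 0).pair (hg 1)))).to₂
  · intro x; simp
  · intro x; simp [h]

theorem bttReducible_one {φ ψ a : ℕ → ℕ} {F : ℕ → ℕ} (ha : Computable a) (hF : Computable F)
    (h : ∀ x, φ x = F (ψ (a x))) : BTTReducible 1 φ ψ := by
  refine ⟨fun x => [a x], fun _ l => F (l.getD 0 0), ?_, ?_, ?_, ?_⟩
  · exact Computable.list_cons.comp ha (Computable.const [])
  · exact (hF.comp ((Primrec.list_getD 0).to_comp.comp Computable.snd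
      (Computable.const 0))).to₂
  · intro x; simp
  · intro x; simp [h]

theorem FunOneReducible.turingReducible {φ ψ : ℕ → ℕ} (h : FunOneReducible φ ψ) :
    TuringReducible (φ : ℕ →. ℕ) (ψ : ℕ →. ℕ) := by
  obtain ⟨k, hk, -, rfl⟩ := h
  exact turingReducible_of_two_queries (F := fun p => p.2.1) hk hk
    (Computable.fst.comp Computable.snd) fun _ => rfl

theorem turingDeg_eq {φ ψ : ℕ → ℕ} (h : TuringReducible (φ : ℕ →. ℕ) (ψ : ℕ →. ℕ))
    (h' : TuringReducible (ψ : ℕ →. ℕ) (φ : ℕ →. ℕ)) : turingDeg φ = turingDeg ψ :=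
  Quotient.sound ⟨h, h'⟩

/-! ### Invariance of distances under isomorphism -/

theorem dist_iso {U V : Type*} {G : SimpleGraph U} {H : SimpleGraph V} (i : G ≃g H) (u v : U) :
    H.dist (i u) (i v) = G.dist u v := by
  rw [SimpleGraph.dist_eq_sInf, SimpleGraph.dist_eq_sInf]
  congr 1
  ext k
  constructor
  · rintro ⟨w, rfl⟩
    exact ⟨(w.map i.symm.toHom).copy (i.symm_apply_apply u) (i.symm_apply_apply v), by simp⟩
  · rintro ⟨w, rfl⟩
    exact ⟨w.map i.toHom, by simp⟩

/-- A computable isomorphism makes the distance functions 1-reducible. -/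
theorem funOneReducible_distFun {G H : SimpleGraph ℕ} (i : G ≃g H)
    (hi : Computable i) : FunOneReducible (distFun G) (distFun H) := by
  refine ⟨fun n => Nat.pair (i n.unpair.1) (i n.unpair.2), ?_, ?_, ?_⟩
  · exact Primrec₂.natPair.to_comp.comp (hi.comp (Computable.fst.comp Computable.unpair))
      (hi.comp (Computable.snd.comp Computable.unpair))
  · intro m n h
    simp only [Nat.pair_eq_pair, EmbeddingLike.apply_eq_iff_eq] at h
    rw [← Nat.pair_unpair m, ← Nat.pair_unpair n, h.1, h.2]
  · funext n
    simpa [distFun] using (dist_iso i n.unpair.1 n.unpair.2).symm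

/-! ### The comb with a hub

The code `(0, 0, 0)` is the hub, `(x, j, 1)` is the `j`-th vertex of the `x`-th tooth, and
`(x, j, s + 2)` is a shortcut from that vertex to the hub which appears at stage `s`. -/

/-- The edges of the comb, each in one direction: the hub is joined to the roots of the teeth and to
all shortcuts, consecutive vertices of a tooth are joined, so are the roots of consecutive teeth,
and a shortcut is joined to its vertex. -/
def CombArc (p q : ℕ × ℕ × ℕ) : Prop :=
  (p.2.2 = 0 ∧ q.2.2 = 1 ∧ q.2.1 = 0) ∨ (p.2.2 = 0 ∧ 2 ≤ q.2.2) ∨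
  (p.2.2 = 1 ∧ q.2.2 = 1 ∧ q.1 = p.1 ∧ q.2.1 = p.2.1 + 1) ∨
  (p.2.2 = 1 ∧ q.2.2 = 1 ∧ p.2.1 = 0 ∧ q.2.1 = 0 ∧ q.1 = p.1 + 1) ∨
  (p.2.2 = 1 ∧ 2 ≤ q.2.2 ∧ q.1 = p.1 ∧ q.2.1 = p.2.1)

def combGraph : SimpleGraph (ℕ × ℕ × ℕ) where
  Adj p q := CombArc p q ∨ CombArc q p
  symm := ⟨fun _ _ h => h.symm⟩
  loopless := ⟨fun p h => by simp only [CombArc] at h; omega⟩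

theorem combGraph_adj {p q : ℕ × ℕ × ℕ} : combGraph.Adj p q ↔ CombArc p q ∨ CombArc q p :=
  Iff.rfl

theorem combGraph_adj_tooth {x j y i t : ℕ} : combGraph.Adj (x, j, 1) (y, i, t) ↔
    (t = 0 ∧ j = 0) ∨ (t = 1 ∧ y = x ∧ (i = j + 1 ∨ j = i + 1)) ∨
      (t = 1 ∧ j = 0 ∧ i = 0 ∧ (y = x + 1 ∨ x = y + 1)) ∨ (2 ≤ t ∧ y = x ∧ i = j) := by
  rcases t with _ | _ | t
  · simp [combGraph_adj, CombArc]
  · simp [combGraph_adj, CombArc]; omega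
  · simp [combGraph_adj, CombArc]

theorem combGraph_adj_hub {y i t : ℕ} :
    combGraph.Adj (0, 0, 0) (y, i, t) ↔ (t = 1 ∧ i = 0) ∨ 2 ≤ t := by
  rcases t with _ | _ | t <;> simp [combGraph_adj, CombArc]

/-- The codes that are vertices: a shortcut at `(x, j)` is present exactly if
`1 ≤ j ≤ g x 0 - g x s + 1` for some `s`, and the first such `s` is part of its code. -/
def IsCombVertex (g : ℕ → ℕ → ℕ) (p : ℕ × ℕ × ℕ) : Prop :=
  (p.1 = 0 ∧ p.2.1 = 0 ∧ p.2.2 = 0) ∨ p.2.2 = 1 ∨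
  (2 ≤ p.2.2 ∧ 1 ≤ p.2.1 ∧ p.2.1 + g p.1 (p.2.2 - 2) ≤ g p.1 0 + 1 ∧
    (p.2.2 = 2 ∨ g p.1 0 + 2 ≤ p.2.1 + g p.1 (p.2.2 - 3)))

/-- The distance of a vertex to the hub, in terms of the limit `a` and the initial value `m` of the
approximation that belongs to its tooth. -/
def hubDist (a m : ℕ) (p : ℕ × ℕ × ℕ) : ℕ :=
  if p.2.2 = 0 then 0
  else if p.2.2 = 1 then min (p.2.1 + 1) (2 + (p.2.1 + a - (m + 1)))
  else 1

/-- The distance in the tree that is left when the hub is removed. -/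
def treeDist (p q : ℕ × ℕ × ℕ) : ℕ :=
  if p = q then 0
  else min (p.2.2 - 1) 1 + min (q.2.2 - 1) 1 +
    if p.1 = q.1 then (p.2.1 - q.2.1) + (q.2.1 - p.2.1)
    else p.2.1 + q.2.1 + ((p.1 - q.1) + (q.1 - p.1))

/-- The distance in the comb of two vertices with given distances `k` and `l` to the hub. -/
def combDist (k l : ℕ) (p q : ℕ × ℕ × ℕ) : ℕ :=
  if p.2.2 = 0 ∨ q.2.2 = 0 then k + l else min (k + l) (treeDist p q)

/-! ### Decidability of the comb and computability of the distance formulas -/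

section Computability

variable {α : Type*} [Primcodable α] {p q : α → ℕ × ℕ × ℕ}

theorem CombArc.computablePred (hp : Computable p) (hq : Computable q) :
    ComputablePred fun a => CombArc (p a) (q a) := by
  have h2 := Computable.snd.comp (Computable.snd.comp hp)
  have h1 := Computable.fst.comp (Computable.snd.comp hp)
  have h0 := Computable.fst.comp hp
  have k2 := Computable.snd.comp (Computable.snd.comp hq)
  have k1 := Computable.fst.comp (Computable.snd.comp hq)
  have k0 := Computable.fst.comp hq
  have c : ∀ n, Computable fun _ : α => (n : ℕ) := Computable.const
  exact ((ComputablePred.eq h2 (c 0)).and ((ComputablePred.eq k2 (c 1)).and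
      (ComputablePred.eq k1 (c 0)))).or <|
    ((ComputablePred.eq h2 (c 0)).and (ComputablePred.natLE (c 2) k2)).or <|
    ((ComputablePred.eq h2 (c 1)).and <| (ComputablePred.eq k2 (c 1)).and <|
      (ComputablePred.eq k0 h0).and (ComputablePred.eq k1 (Computable.succ.comp h1))).or <|
    ((ComputablePred.eq h2 (c 1)).and <| (ComputablePred.eq k2 (c 1)).and <|
      (ComputablePred.eq h1 (c 0)).and <| (ComputablePred.eq k1 (c 0)).and
      (ComputablePred.eq k0 (Computable.succ.comp h0))).or <|
    (ComputablePred.eq h2 (c 1)).and <| (ComputablePred.natLE (c 2) k2).and <|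
      (ComputablePred.eq k0 h0).and (ComputablePred.eq k1 h1)

theorem combGraph_adj_computablePred (hp : Computable p) (hq : Computable q) :
    ComputablePred fun a => combGraph.Adj (p a) (q a) :=
  (CombArc.computablePred hp hq).or (CombArc.computablePred hq hp)

theorem IsCombVertex.computablePred {g : ℕ → ℕ → ℕ} (hg : Computable₂ g) :
    ComputablePred (IsCombVertex g) := by
  have h2 : Computable fun p : ℕ × ℕ × ℕ => p.2.2 := Computable.snd.comp Computable.snd
  have h1 : Computable fun p : ℕ × ℕ × ℕ => p.2.1 := Computable.fst.comp Computable.snd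
  have h0 : Computable fun p : ℕ × ℕ × ℕ => p.1 := Computable.fst
  have c : ∀ n, Computable fun _ : ℕ × ℕ × ℕ => (n : ℕ) := Computable.const
  exact ((ComputablePred.eq h0 (c 0)).and <| (ComputablePred.eq h1 (c 0)).and
      (ComputablePred.eq h2 (c 0))).or <|
    (ComputablePred.eq h2 (c 1)).or <|
    (ComputablePred.natLE (c 2) h2).and <| (ComputablePred.natLE (c 1) h1).and <|
      (ComputablePred.natLE (Computable.natAdd h1 (hg.comp h0 (Computable.natSub h2 (c 2))))
        (Computable.natAdd (hg.comp h0 (c 0)) (c 1))).and <|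
      (ComputablePred.eq h2 (c 2)).or <|
      ComputablePred.natLE (Computable.natAdd (hg.comp h0 (c 0)) (c 2))
        (Computable.natAdd h1 (hg.comp h0 (Computable.natSub h2 (c 3))))

theorem Computable.ite_of_computablePred {σ : Type*} [Primcodable σ] {P : α → Prop}
    [DecidablePred P] {h k : α → σ} (hP : ComputablePred P) (hh : Computable h)
    (hk : Computable k) : Computable fun a => if P a then h a else k a :=
  (Computable.cond hP.decide hh hk).of_eq fun a => by by_cases ha : P a <;> simp [ha]

theorem hubDist_computable {a m : α → ℕ} (ha : Computable a) (hm : Computable m)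
    (hp : Computable p) : Computable fun x => hubDist (a x) (m x) (p x) := by
  have h2 := Computable.snd.comp (Computable.snd.comp hp)
  have h1 := Computable.fst.comp (Computable.snd.comp hp)
  have c : ∀ n, Computable fun _ : α => (n : ℕ) := Computable.const
  exact Computable.ite_of_computablePred (ComputablePred.eq h2 (c 0)) (c 0) <|
    Computable.ite_of_computablePred (ComputablePred.eq h2 (c 1))
      (Primrec.nat_min.to_comp.comp (Computable.natAdd h1 (c 1))
        (Computable.natAdd (c 2) (Computable.natSub (Computable.natAdd h1 ha)
          (Computable.natAdd hm (c 1))))) (c 1)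

theorem treeDist_computable (hp : Computable p) (hq : Computable q) :
    Computable fun x => treeDist (p x) (q x) := by
  have h2 := Computable.snd.comp (Computable.snd.comp hp)
  have h1 := Computable.fst.comp (Computable.snd.comp hp)
  have h0 := Computable.fst.comp hp
  have k2 := Computable.snd.comp (Computable.snd.comp hq)
  have k1 := Computable.fst.comp (Computable.snd.comp hq)
  have k0 := Computable.fst.comp hq
  have c : ∀ n, Computable fun _ : α => (n : ℕ) := Computable.const
  exact Computable.ite_of_computablePred (ComputablePred.eq hp hq) (c 0) <|
    Computable.natAdd (Computable.natAdd
      (Primrec.nat_min.to_comp.comp (Computable.natSub h2 (c 1)) (c 1))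
      (Primrec.nat_min.to_comp.comp (Computable.natSub k2 (c 1)) (c 1))) <|
    Computable.ite_of_computablePred (ComputablePred.eq h0 k0)
      (Computable.natAdd (Computable.natSub h1 k1) (Computable.natSub k1 h1))
      (Computable.natAdd (Computable.natAdd h1 k1)
        (Computable.natAdd (Computable.natSub h0 k0) (Computable.natSub k0 h0)))

theorem combDist_computable {k l : α → ℕ} (hk : Computable k) (hl : Computable l)
    (hp : Computable p) (hq : Computable q) :
    Computable fun x => combDist (k x) (l x) (p x) (q x) := by
  have h2 := Computable.snd.comp (Computable.snd.comp hp)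
  have k2 := Computable.snd.comp (Computable.snd.comp hq)
  have c : ∀ n, Computable fun _ : α => (n : ℕ) := Computable.const
  exact Computable.ite_of_computablePred
    ((ComputablePred.eq h2 (c 0)).or (ComputablePred.eq k2 (c 0))) (Computable.natAdd hk hl)
    (Primrec.nat_min.to_comp.comp (Computable.natAdd hk hl) (treeDist_computable hp hq))

end Computability

/-! ### Distances in the comb -/

section Distance

variable {f : ℕ → ℕ} {g : ℕ → ℕ → ℕ}

theorem IsCombVertex.tooth (x j : ℕ) : IsCombVertex g (x, j, 1) := Or.inr (Or.inl rfl)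

theorem IsCombVertex.hub : IsCombVertex g (0, 0, 0) := Or.inl ⟨rfl, rfl, rfl⟩

theorem IsCombVertex.eq_hub {p : ℕ × ℕ × ℕ} (h : IsCombVertex g p) (h0 : p.2.2 = 0) :
    p = (0, 0, 0) := by
  obtain ⟨x, j, t⟩ := p
  simp only [IsCombVertex, Prod.mk.injEq] at *
  omega

theorem IsCombVertex.hub_or_tooth_or_shortcut {x j t : ℕ} (h : IsCombVertex g (x, j, t)) :
    (t = 0 ∧ x = 0 ∧ j = 0) ∨ t = 1 ∨ (2 ≤ t ∧ 1 ≤ j) := by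
  simp only [IsCombVertex] at h
  omega

/-- A code records the first stage at which its height is admitted, and by monotonicity an admitted
height stays admitted. -/
theorem IsCombVertex.shortcut_unique (hg : ∀ x s, g x (s + 1) ≤ g x s) {x j s t : ℕ}
    (hs : IsCombVertex g (x, j, s)) (ht : IsCombVertex g (x, j, t)) (h2 : 2 ≤ s) (h2' : 2 ≤ t) :
    s = t := by
  have hanti : Antitone (g x) := antitone_nat_of_succ_le (hg x)
  have key : ∀ {s t : ℕ}, IsCombVertex g (x, j, s) → IsCombVertex g (x, j, t) → 2 ≤ s →
      ¬ s < t := by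
    intro s t hs ht h2 hlt
    have := hanti (show s - 2 ≤ t - 3 by omega)
    simp only [IsCombVertex] at hs ht
    omega
  have := key hs ht h2
  have := key ht hs h2'
  omega

theorem IsCombVertex.add_le (hfg : ∀ x s, f x ≤ g x s) {x j t : ℕ}
    (h : IsCombVertex g (x, j, t)) (ht : 2 ≤ t) : 1 ≤ j ∧ j + f x ≤ g x 0 + 1 := by
  have := hfg x (t - 2)
  simp only [IsCombVertex] at h
  omega

theorem exists_shortcut (hlim : ∀ x, ∃ s, g x s = f x) {x j : ℕ} (hj : 1 ≤ j)
    (h : j + f x ≤ g x 0 + 1) : ∃ t, 2 ≤ t ∧ IsCombVertex g (x, j, t) := by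
  classical
  have hex : ∃ s, j + g x s ≤ g x 0 + 1 := (hlim x).imp fun s hs => by rw [hs]; exact h
  -- Stage `s` is coded as `s + 2`; minimality of the stage gives the clause about the preceding
  -- stage.
  refine ⟨Nat.find hex + 2, by omega, Or.inr (Or.inr ⟨by simp, hj, Nat.find_spec hex, ?_⟩)⟩
  rcases Nat.eq_zero_or_pos (Nat.find hex) with h0 | h0
  · left; simp [h0]
  · right
    have := Nat.find_min hex (Nat.sub_one_lt_of_lt h0)
    simp only [show Nat.find hex + 2 - 3 = Nat.find hex - 1 by omega]
    omega

theorem SimpleGraph.le_add_dist_of_lipschitz {V : Type*} {G : SimpleGraph V} (hG : G.Connected)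
    {φ : V → ℕ} (hφ : ∀ u v, G.Adj u v → φ u ≤ φ v + 1) (u v : V) : φ u ≤ φ v + G.dist u v := by
  obtain ⟨w, hw⟩ := hG.exists_walk_length_eq_dist u v
  rw [← hw]
  clear hw
  induction w with
  | nil => simp
  | cons h _ ih =>
    have := hφ _ _ h
    rw [SimpleGraph.Walk.length_cons]
    omega

variable (f g) in
/-- The distance to the hub in the comb built from the approximation `g` of `f`. -/
abbrev hubDistOf (p : ℕ × ℕ × ℕ) : ℕ := hubDist (f p.1) (g p.1 0) p

/-- The delicate edges join a shortcut to its foot: there `IsCombVertex.add_le` bounds the hub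
distance of the foot by 2. -/
theorem hubDistOf_le_of_adj (hfg : ∀ x s, f x ≤ g x s) {p q : ℕ × ℕ × ℕ} (hp : IsCombVertex g p)
    (hq : IsCombVertex g q) (h : combGraph.Adj p q) : hubDistOf f g p ≤ hubDistOf f g q + 1 := by
  obtain ⟨x, j, t⟩ := p
  obtain ⟨y, i, s⟩ := q
  have h1 := hp.add_le hfg
  have h2 := hq.add_le hfg
  have := hfg x 0
  have := hfg y 0
  rcases eq_or_ne x y with rfl | hxy
  · simp only [combGraph_adj, CombArc] at h
    simp only [hubDistOf, hubDist]
    split_ifs <;> omega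
  · simp only [combGraph_adj, CombArc] at h
    simp only [hubDistOf, hubDist]
    split_ifs <;> omega

theorem hubDistOf_le_treeDist (hfg : ∀ x s, f x ≤ g x s) {p q : ℕ × ℕ × ℕ}
    (hp : IsCombVertex g p) (hp0 : p.2.2 ≠ 0) (hq0 : q.2.2 ≠ 0) :
    hubDistOf f g q ≤ treeDist p q + hubDistOf f g p := by
  obtain ⟨x, j, t⟩ := p
  obtain ⟨y, i, s⟩ := q
  have h1 := hp.add_le hfg
  have := hfg x 0
  have := hfg y 0
  rcases eq_or_ne x y with rfl | hxy
  · simp only [hubDistOf, hubDist, treeDist, Prod.mk.injEq, true_and, if_true] at *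
    split_ifs <;> omega
  · simp only [hubDistOf, hubDist, treeDist, Prod.mk.injEq, hxy, false_and, if_false] at *
    split_ifs <;> omega

theorem treeDist_self (p : ℕ × ℕ × ℕ) : treeDist p p = 0 := by simp [treeDist]

theorem treeDist_same_tooth {x j t i s : ℕ} (h : (x, j, t) ≠ (x, i, s)) :
    treeDist (x, j, t) (x, i, s) =
      min (t - 1) 1 + min (s - 1) 1 + ((j - i) + (i - j)) := by
  simp [treeDist, h]

theorem treeDist_other_tooth {x j t y i s : ℕ} (h : x ≠ y) :
    treeDist (x, j, t) (y, i, s) =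
      min (t - 1) 1 + min (s - 1) 1 + (j + i + ((x - y) + (y - x))) := by
  simp [treeDist, h]

/-- Arcs are oriented, so both inequalities are needed to cover edges. The cases where an endpoint
equals `r` are separate because the leaf terms of the formula vanish there. -/
theorem treeDist_le_of_arc {p q : ℕ × ℕ × ℕ} (r : ℕ × ℕ × ℕ) (h : CombArc p q)
    (hp : p.2.2 ≠ 0) :
    treeDist p r ≤ treeDist q r + 1 ∧ treeDist q r ≤ treeDist p r + 1 := by
  obtain ⟨x, j, t⟩ := p
  obtain ⟨y, i, s⟩ := q
  obtain ⟨z, k, o⟩ := r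
  have htooth : ∀ {x j t i s : ℕ}, min (t - 1) 1 + min (s - 1) 1 + ((j - i) + (i - j)) ≤ 1 →
      treeDist (x, j, t) (x, i, s) ≤ 1 := fun {x j t i s} h => by
    by_cases h' : (x, j, t) = (x, i, s)
    · rw [h', treeDist_self]; omega
    · rwa [treeDist_same_tooth h']
  simp only [CombArc] at h hp
  by_cases h1 : (x, j, t) = (z, k, o)
  · rw [h1, treeDist_self]
    obtain ⟨rfl, rfl, rfl⟩ : x = z ∧ j = k ∧ t = o := by simpa using h1
    refine ⟨by omega, ?_⟩
    rcases h with h | h | ⟨rfl, rfl, rfl, rfl⟩ | ⟨rfl, rfl, rfl, rfl, rfl⟩ | ⟨rfl, h, rfl, rfl⟩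
    · omega
    · omega
    · exact htooth (by omega)
    · rw [treeDist_other_tooth (by omega)]; omega
    · exact htooth (by omega)
  by_cases h2 : (y, i, s) = (z, k, o)
  · rw [h2, treeDist_self]
    obtain ⟨rfl, rfl, rfl⟩ : y = z ∧ i = k ∧ s = o := by simpa using h2
    refine ⟨?_, by omega⟩
    rcases h with h | h | ⟨rfl, rfl, rfl, rfl⟩ | ⟨rfl, rfl, rfl, rfl, rfl⟩ | ⟨rfl, h, rfl, rfl⟩
    · omega
    · omega
    · exact htooth (by omega)
    · rw [treeDist_other_tooth (by omega)]; omega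
    · exact htooth (by omega)
  rcases h with h | h | ⟨rfl, rfl, rfl, rfl⟩ | ⟨rfl, rfl, rfl, rfl, rfl⟩ | ⟨rfl, h, rfl, rfl⟩
  · omega
  · omega
  · rcases eq_or_ne y z with rfl | hz
    · rw [treeDist_same_tooth h1, treeDist_same_tooth h2]; omega
    · rw [treeDist_other_tooth hz, treeDist_other_tooth hz]; omega
  · rcases eq_or_ne x z with rfl | hz
    · rw [treeDist_same_tooth h1, treeDist_other_tooth (by omega)]; omega
    · rw [treeDist_other_tooth hz]
      rcases eq_or_ne (x + 1) z with rfl | hz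
      · rw [treeDist_same_tooth h2]; omega
      · rw [treeDist_other_tooth hz]; omega
  · rcases eq_or_ne y z with rfl | hz
    · rw [treeDist_same_tooth h1, treeDist_same_tooth h2]; omega
    · rw [treeDist_other_tooth hz, treeDist_other_tooth hz]; omega

theorem treeDist_le_of_adj {p q : ℕ × ℕ × ℕ} (r : ℕ × ℕ × ℕ) (h : combGraph.Adj p q)
    (hp : p.2.2 ≠ 0) (hq : q.2.2 ≠ 0) : treeDist p r ≤ treeDist q r + 1 := by
  rcases h with h | h
  · exact (treeDist_le_of_arc r h hp).1
  · exact (treeDist_le_of_arc r h hq).2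

theorem combDist_le_of_adj (hfg : ∀ x s, f x ≤ g x s) {p q r : ℕ × ℕ × ℕ}
    (hp : IsCombVertex g p) (hq : IsCombVertex g q) (h : combGraph.Adj p q) :
    combDist (hubDistOf f g p) (hubDistOf f g r) p r ≤
      combDist (hubDistOf f g q) (hubDistOf f g r) q r + 1 := by
  have hh := hubDistOf_le_of_adj hfg hp hq h
  have h0 : ∀ v : ℕ × ℕ × ℕ, v.2.2 = 0 → hubDistOf f g v = 0 := fun v hv => by
    simp [hubDist, hv]
  rcases eq_or_ne r.2.2 0 with hr | hr
  · simp only [combDist, hr, or_true, if_true]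
    omega
  rcases eq_or_ne p.2.2 0 with hp0 | hp0 <;> rcases eq_or_ne q.2.2 0 with hq0 | hq0
  · simp only [combDist, hp0, hq0, true_or, if_true]; omega
  -- Stepping off the hub: a neighbour `q` has hub distance at most 1, so a path from `q` to `r` in
  -- the tree cannot be shorter than the hub distance of `r` by more than 1.
  · have := hubDistOf_le_treeDist (q := r) hfg hq hq0 hr
    have hq1 := hubDistOf_le_of_adj hfg hq hp h.symm
    simp only [combDist, hp0, hq0, hr, h0 p hp0, true_or, or_self, if_true, if_false] at *
    omega
  · simp only [combDist, hp0, hq0, hr, h0 q hq0, true_or, or_self, if_true, if_false] at *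
    omega
  · have := treeDist_le_of_adj r h hp0 hq0
    simp only [combDist, hp0, hq0, hr, or_self, if_false]
    omega

/-! ### Walks that attain the distance formula -/

variable {e : ℕ → ℕ × ℕ × ℕ}

/-- The comb as a graph with domain `ω`, along an enumeration `e` of its vertices. -/
def comb (e : ℕ → ℕ × ℕ × ℕ) : SimpleGraph ℕ := combGraph.comap e

/-- There are vertices with codes `p` and `q` joined by a walk of length at most `k`. -/
def Within (e : ℕ → ℕ × ℕ × ℕ) (k : ℕ) (p q : ℕ × ℕ × ℕ) : Prop :=
  ∃ u v, e u = p ∧ e v = q ∧ ∃ w : (comb e).Walk u v, w.length ≤ k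

theorem Within.symm {k : ℕ} {p q : ℕ × ℕ × ℕ} (h : Within e k p q) : Within e k q p := by
  obtain ⟨u, v, hu, hv, w, hw⟩ := h
  exact ⟨v, u, hv, hu, w.reverse, by simpa using hw⟩

theorem Within.mono {k l : ℕ} {p q : ℕ × ℕ × ℕ} (h : Within e k p q) (hkl : k ≤ l) :
    Within e l p q := by
  obtain ⟨u, v, hu, hv, w, hw⟩ := h
  exact ⟨u, v, hu, hv, w, hw.trans hkl⟩

theorem Within.trans (hinj : Function.Injective e) {k l : ℕ} {p q r : ℕ × ℕ × ℕ}
    (h : Within e k p q) (h' : Within e l q r) : Within e (k + l) p r := by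
  obtain ⟨u, v, hu, hv, w, hw⟩ := h
  obtain ⟨v', z, hv', hz, w', hw'⟩ := h'
  obtain rfl : v = v' := hinj (hv.trans hv'.symm)
  exact ⟨u, z, hu, hz, w.append w', by rw [SimpleGraph.Walk.length_append]; omega⟩

theorem Within.refl (he : ∀ p, IsCombVertex g p ↔ ∃ n, e n = p)
    {p : ℕ × ℕ × ℕ} (hp : IsCombVertex g p) : Within e 0 p p := by
  obtain ⟨n, hn⟩ := (he p).1 hp
  exact ⟨n, n, hn, hn, .nil, by simp⟩

theorem Within.of_adj (he : ∀ p, IsCombVertex g p ↔ ∃ n, e n = p)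
    {p q : ℕ × ℕ × ℕ} (hp : IsCombVertex g p) (hq : IsCombVertex g q)
    (h : combGraph.Adj p q) : Within e 1 p q := by
  obtain ⟨m, rfl⟩ := (he p).1 hp
  obtain ⟨n, rfl⟩ := (he q).1 hq
  exact ⟨m, n, rfl, rfl, SimpleGraph.Walk.cons (show (comb e).Adj m n from h) .nil, by simp⟩

end Distance

section Distance

variable {f : ℕ → ℕ} {g : ℕ → ℕ → ℕ} {e : ℕ → ℕ × ℕ × ℕ}

theorem within_tooth (hinj : Function.Injective e) (he : ∀ p, IsCombVertex g p ↔ ∃ n, e n = p)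
    (x i j : ℕ) : Within e ((i - j) + (j - i)) (x, i, 1) (x, j, 1) := by
  have key : ∀ i n, Within e n (x, i, 1) (x, i + n, 1) := by
    intro i n
    induction n with
    | zero => exact .refl he (.tooth x i)
    | succ n ih =>
      exact ih.trans hinj (.of_adj he (.tooth _ _) (.tooth _ _)
        (by rw [combGraph_adj_tooth]; omega))
  rcases le_total i j with h | h
  · have := key i (j - i)
    rw [Nat.add_sub_cancel' h] at this
    exact this.mono (by omega)
  · have := (key j (i - j)).symm
    rw [Nat.add_sub_cancel' h] at this
    exact this.mono (by omega)

theorem within_spine (hinj : Function.Injective e) (he : ∀ p, IsCombVertex g p ↔ ∃ n, e n = p)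
    (x y : ℕ) : Within e ((x - y) + (y - x)) (x, 0, 1) (y, 0, 1) := by
  have key : ∀ x n, Within e n (x, 0, 1) (x + n, 0, 1) := by
    intro x n
    induction n with
    | zero => exact .refl he (.tooth x 0)
    | succ n ih =>
      exact ih.trans hinj (.of_adj he (.tooth _ _) (.tooth _ _)
        (by rw [combGraph_adj_tooth]; omega))
  rcases le_total x y with h | h
  · have := key x (y - x)
    rw [Nat.add_sub_cancel' h] at this
    exact this.mono (by omega)
  · have := (key y (x - y)).symm
    rw [Nat.add_sub_cancel' h] at this
    exact this.mono (by omega)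

theorem within_treeDist (hinj : Function.Injective e)
    (he : ∀ p, IsCombVertex g p ↔ ∃ n, e n = p) {p q : ℕ × ℕ × ℕ} (hp : IsCombVertex g p)
    (hq : IsCombVertex g q) (hp0 : p.2.2 ≠ 0) (hq0 : q.2.2 ≠ 0) :
    Within e (treeDist p q) p q := by
  have hfoot : ∀ {x j t : ℕ}, IsCombVertex g (x, j, t) → t ≠ 0 →
      Within e (min (t - 1) 1) (x, j, t) (x, j, 1) := by
    intro x j t h h0
    rcases eq_or_ne t 1 with rfl | h1
    · exact .refl he h
    · exact (Within.of_adj he (.tooth x j) h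
        (by rw [combGraph_adj_tooth]; omega)).symm.mono (by omega)
  by_cases hpq : p = q
  · rw [hpq, treeDist_self]
    exact .refl he hq
  obtain ⟨x, j, t⟩ := p
  obtain ⟨y, i, s⟩ := q
  have h1 := hfoot hp hp0
  have h2 := (hfoot hq hq0).symm
  rcases eq_or_ne x y with rfl | hxy
  · rw [treeDist_same_tooth hpq]
    exact ((h1.trans hinj (within_tooth hinj he x j i)).trans hinj h2).mono (by omega)
  · rw [treeDist_other_tooth hxy]
    exact ((((h1.trans hinj (within_tooth hinj he x j 0)).trans hinj
      (within_spine hinj he x y)).trans hinj (within_tooth hinj he y 0 i)).trans hinj h2).mono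
      (by omega)

theorem within_hubDistOf (hlim : ∀ x, ∃ s, g x s = f x) (hinj : Function.Injective e)
    (he : ∀ p, IsCombVertex g p ↔ ∃ n, e n = p) {p : ℕ × ℕ × ℕ} (hp : IsCombVertex g p) :
    Within e (hubDistOf f g p) p (0, 0, 0) := by
  obtain ⟨x, j, t⟩ := p
  rcases eq_or_ne t 0 with rfl | h0
  · rw [hp.eq_hub rfl]
    exact (Within.refl he .hub).mono (Nat.zero_le _)
  rcases eq_or_ne t 1 with rfl | h1
  · have hd : ∀ j, hubDistOf f g (x, j, 1) = min (j + 1) (2 + (j + f x - (g x 0 + 1))) :=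
      fun j => rfl
    induction j with
    | zero =>
      refine (Within.of_adj he (.tooth x 0) .hub ?_).mono (by rw [hd]; omega)
      simp [combGraph_adj_tooth]
    | succ j ih =>
      by_cases hj : j + 1 + f x ≤ g x 0 + 1
      · obtain ⟨t, ht, hv⟩ := exists_shortcut hlim (by omega) hj
        refine ((Within.of_adj he (.tooth x (j + 1)) hv ?_).trans hinj
          (Within.of_adj he .hub hv ?_).symm).mono (by rw [hd]; omega)
        · rw [combGraph_adj_tooth]; omega
        · rw [combGraph_adj_hub]; omega
      · refine ((Within.of_adj he (.tooth x (j + 1)) (.tooth x j) ?_).trans hinj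
          (ih (.tooth x j))).mono (by rw [hd, hd]; omega)
        rw [combGraph_adj_tooth]; omega
  · refine (Within.of_adj he .hub hp ?_).symm.mono (by simp [hubDist, h0, h1])
    rw [combGraph_adj_hub]; omega

theorem within_combDist (hlim : ∀ x, ∃ s, g x s = f x) (hinj : Function.Injective e)
    (he : ∀ p, IsCombVertex g p ↔ ∃ n, e n = p) {p q : ℕ × ℕ × ℕ} (hp : IsCombVertex g p)
    (hq : IsCombVertex g q) :
    Within e (combDist (hubDistOf f g p) (hubDistOf f g q) p q) p q := by
  have h := (within_hubDistOf hlim hinj he hp).trans hinj (within_hubDistOf hlim hinj he hq).symm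
  by_cases h0 : p.2.2 = 0 ∨ q.2.2 = 0
  · simpa only [combDist, h0, if_true] using h
  · simp only [combDist, h0, if_false]
    rw [not_or] at h0
    rcases min_choice (hubDistOf f g p + hubDistOf f g q) (treeDist p q) with hm | hm <;> rw [hm]
    · exact h
    · exact within_treeDist hinj he hp hq h0.1 h0.2

theorem comb_connected (hlim : ∀ x, ∃ s, g x s = f x) (hinj : Function.Injective e)
    (he : ∀ p, IsCombVertex g p ↔ ∃ n, e n = p) : (comb e).Connected := by
  refine ⟨fun u v => ?_⟩
  obtain ⟨u', v', hu, hv, w, -⟩ :=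
    within_combDist hlim hinj he ((he _).2 ⟨u, rfl⟩) ((he _).2 ⟨v, rfl⟩)
  rw [← hinj hu, ← hinj hv]
  exact ⟨w⟩

/-- Explicit walks give the upper bound. For the lower bound, the formula with `v` fixed changes by
at most 1 along each edge and vanishes at `v`. -/
theorem comb_dist (hfg : ∀ x s, f x ≤ g x s) (hlim : ∀ x, ∃ s, g x s = f x)
    (hinj : Function.Injective e) (he : ∀ p, IsCombVertex g p ↔ ∃ n, e n = p) (u v : ℕ) :
    (comb e).dist u v =
      combDist (hubDistOf f g (e u)) (hubDistOf f g (e v)) (e u) (e v) := by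
  apply le_antisymm
  · obtain ⟨u', v', hu, hv, w, hw⟩ :=
      within_combDist hlim hinj he ((he _).2 ⟨u, rfl⟩) ((he _).2 ⟨v, rfl⟩)
    rw [← hinj hu, ← hinj hv] at hw ⊢
    exact (SimpleGraph.dist_le w).trans hw
  · have h := SimpleGraph.le_add_dist_of_lipschitz (comb_connected hlim hinj he)
      (φ := fun u => combDist (hubDistOf f g (e u)) (hubDistOf f g (e v)) (e u) (e v))
      (fun a b hab => combDist_le_of_adj hfg ((he _).2 ⟨a, rfl⟩) ((he _).2 ⟨b, rfl⟩) hab) u v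
    have h0 : combDist (hubDistOf f g (e v)) (hubDistOf f g (e v)) (e v) (e v) = 0 := by
      by_cases hv : (e v).2.2 = 0
      · simp [combDist, hubDist, hv]
      · simp [combDist, treeDist_self, hv]
    omega

end Distance

/-! ### Every computable copy of the comb is computably isomorphic to it -/

section Categoricity

variable {g : ℕ → ℕ → ℕ} {e : ℕ → ℕ × ℕ × ℕ}

theorem comb_iso_computable (hg : ∀ x s, g x (s + 1) ≤ g x s) (hec : Computable e)
    (hinj : Function.Injective e) (he : ∀ p, IsCombVertex g p ↔ ∃ n, e n = p)
    {H : SimpleGraph ℕ} (hH : ComputableGraph H) (i : comb e ≃g H) : Computable i := by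
  -- The image in `H` of the vertex with a given code; junk at codes that are not vertices.
  let a : ℕ × ℕ × ℕ → ℕ := fun p => i (Function.invFun e p)
  have hae : ∀ n, a (e n) = i n := fun n =>
    congrArg i (Function.leftInverse_invFun hinj n)
  have hadj : ∀ p q, IsCombVertex g p → IsCombVertex g q →
      (H.Adj (a p) (a q) ↔ combGraph.Adj p q) := by
    intro p q hp hq
    obtain ⟨m, rfl⟩ := (he p).1 hp
    obtain ⟨n, rfl⟩ := (he q).1 hq
    rw [hae, hae]
    exact i.map_adj_iff
  have hainj : ∀ p q, IsCombVertex g p → IsCombVertex g q → (a p = a q ↔ p = q) := by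
    intro p q hp hq
    obtain ⟨m, rfl⟩ := (he p).1 hp
    obtain ⟨n, rfl⟩ := (he q).1 hq
    rw [hae, hae, i.injective.eq_iff, hinj.eq_iff]
  have hsurj : ∀ y, ∃ x j t, IsCombVertex g (x, j, t) ∧ y = a (x, j, t) := by
    intro y
    refine ⟨_, _, _, (he (e (i.symm y))).2 ⟨_, rfl⟩, ?_⟩
    rw [hae, i.apply_symm_apply]
  have hhub := IsCombVertex.hub (g := g)
  have htooth := IsCombVertex.tooth (g := g)
  have hHadj : ∀ {α : Type} [Primcodable α] {h k : α → ℕ}, Computable h → Computable k →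
      ComputablePred fun c => H.Adj (h c) (k c) := fun hh hk =>
    ComputablePred.comp hH (hh.pair hk)
  -- The images of the hub and the first two roots are hardwired constants. The next root is the
  -- only neighbour of the current root, besides the previous one, that is adjacent to the hub:
  -- roots carry no shortcuts.
  have hspine : Computable fun x => a (x, 0, 1) := by
    have : Computable₂ fun (_ : Unit) x => a (x, 0, 1) := by
      refine Computable₂.of_step
        (P := fun c => H.Adj c.1.2 c.2 ∧ H.Adj (a (0, 0, 0)) c.2 ∧ ¬ c.2 = c.1.1)
        ((hHadj (Computable.snd.comp Computable.fst) Computable.snd).and <|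
          (hHadj (Computable.const _) Computable.snd).and
          (ComputablePred.eq Computable.snd (Computable.fst.comp Computable.fst)).not)
        (Computable.const _) (Computable.const _) ?_
      intro _ n y
      obtain ⟨x, j, t, hp, rfl⟩ := hsurj y
      simp only [hadj _ _ (htooth _ _) hp, hadj _ _ hhub hp, hainj _ _ hp (htooth _ _)]
      have := hp.hub_or_tooth_or_shortcut
      simp only [combGraph_adj_tooth, combGraph_adj_hub, Prod.mk.injEq, true_and]
      omega
    exact this.comp (Computable.const ()) Computable.id
  have hfirst : Computable fun x => a (x, 1, 1) := by
    refine Computable.of_computablePred_graph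
      (P := fun c => H.Adj (a (c.1, 0, 1)) c.2 ∧ ¬ H.Adj (a (0, 0, 0)) c.2 ∧
        ¬ c.2 = a (0, 0, 0))
      ((hHadj (hspine.comp Computable.fst) Computable.snd).and <|
        (hHadj (Computable.const _) Computable.snd).not.and
        (ComputablePred.eq Computable.snd (Computable.const _)).not) ?_
    intro x y
    obtain ⟨x', j, t, hp, rfl⟩ := hsurj y
    simp only [hadj _ _ (htooth _ _) hp, hadj _ _ hhub hp, hainj _ _ hp (htooth _ _),
      hainj _ _ hp hhub]
    have := hp.hub_or_tooth_or_shortcut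
    simp only [combGraph_adj_tooth, combGraph_adj_hub, Prod.mk.injEq, true_and]
    omega
  -- Going up a tooth, adjacency to the hub excludes the shortcut, and the previous vertex is
  -- excluded by name.
  have hteeth : Computable₂ fun x j => a (x, j, 1) := by
    refine Computable₂.of_step
      (P := fun c => H.Adj c.1.2 c.2 ∧ ¬ H.Adj (a (0, 0, 0)) c.2 ∧ ¬ c.2 = c.1.1)
      ((hHadj (Computable.snd.comp Computable.fst) Computable.snd).and <|
        (hHadj (Computable.const _) Computable.snd).not.and
        (ComputablePred.eq Computable.snd (Computable.fst.comp Computable.fst)).not)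
      hspine hfirst ?_
    intro x n y
    obtain ⟨x', j, t, hp, rfl⟩ := hsurj y
    simp only [hadj _ _ (htooth _ _) hp, hadj _ _ hhub hp, hainj _ _ hp (htooth _ _)]
    have := hp.hub_or_tooth_or_shortcut
    simp only [combGraph_adj_tooth, combGraph_adj_hub, Prod.mk.injEq]
    omega
  have h2 : Computable fun c : ℕ × ℕ => (e c.1).2.2 :=
    Computable.snd.comp (Computable.snd.comp (hec.comp Computable.fst))
  have h1 : Computable fun c : ℕ × ℕ => (e c.1).2.1 :=
    Computable.fst.comp (Computable.snd.comp (hec.comp Computable.fst))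
  have h0 : Computable fun c : ℕ × ℕ => (e c.1).1 := Computable.fst.comp (hec.comp Computable.fst)
  -- A shortcut is a common neighbour of its foot and the hub. The exclusion of the vertex below
  -- matters only at height 1, where the root is another common neighbour.
  refine Computable.of_computablePred_graph
    (P := fun c : ℕ × ℕ => ((e c.1).2.2 = 0 ∧ c.2 = a (0, 0, 0)) ∨
      ((e c.1).2.2 = 1 ∧ c.2 = a ((e c.1).1, (e c.1).2.1, 1)) ∨
      (2 ≤ (e c.1).2.2 ∧ H.Adj (a ((e c.1).1, (e c.1).2.1, 1)) c.2 ∧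
        H.Adj (a (0, 0, 0)) c.2 ∧ ¬ c.2 = a ((e c.1).1, (e c.1).2.1 - 1, 1)))
    (((ComputablePred.eq h2 (Computable.const 0)).and
        (ComputablePred.eq Computable.snd (Computable.const _))).or <|
      ((ComputablePred.eq h2 (Computable.const 1)).and
        (ComputablePred.eq Computable.snd (hteeth.comp h0 h1))).or <|
      (ComputablePred.natLE (Computable.const 2) h2).and <|
        (hHadj (hteeth.comp h0 h1) Computable.snd).and <|
        (hHadj (Computable.const _) Computable.snd).and
        (ComputablePred.eq Computable.snd
          (hteeth.comp h0 (Computable.natSub h1 (Computable.const 1)))).not) ?_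
  intro n y
  rw [← hae n]
  obtain ⟨x, j, t, hp, rfl⟩ := hsurj y
  have hn : IsCombVertex g (e n) := (he _).2 ⟨n, rfl⟩
  dsimp only
  generalize e n = v at hn ⊢
  obtain ⟨x', j', t'⟩ := v
  simp only [hadj _ _ (htooth _ _) hp, hadj _ _ hhub hp, hainj _ _ hp (htooth _ _),
    hainj _ _ hp hhub, hainj _ _ hp hn]
  have hu : 2 ≤ t → 2 ≤ t' → x = x' → j = j' → t = t' := by
    rintro h h' rfl rfl
    exact hp.shortcut_unique hg hn h h'
  have := hp.hub_or_tooth_or_shortcut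
  simp only [combGraph_adj_tooth, combGraph_adj_hub, Prod.mk.injEq]
  rcases hn.hub_or_tooth_or_shortcut with ⟨rfl, rfl, rfl⟩ | rfl | ⟨h2, h1⟩
  · simp
  · simp
  · omega

end Categoricity

/-! ### The theorem -/

theorem theorem4p2 (f : ℕ → ℕ) (hf : ApproximableFromAbove f) :
    ∃ G : SimpleGraph ℕ, ComputableGraph G ∧ G.Connected ∧
      distSpectrum G = {turingDeg f} ∧
      ∀ H : SimpleGraph ℕ, ComputableGraph H → Nonempty (G ≃g H) →
        FunOneEquiv (distFun H) (distFun G) ∧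
        BTTReducible 2 (distFun G) f ∧
        BTTReducible 1 f (distFun H) := by
  obtain ⟨g, hgc, hg, hgf⟩ := hf
  have hlim : ∀ x, ∃ s, g x s = f x := fun x => (hgf x).exists
  have hfg : ∀ x s, f x ≤ g x s := by
    intro x s
    obtain ⟨t, ht, hst⟩ := ((hgf x).and (Filter.eventually_ge_atTop s)).exists
    exact ht ▸ antitone_nat_of_succ_le (hg x) hst
  obtain ⟨e, hec, hinj, he⟩ := (IsCombVertex.computablePred hgc).exists_enum
    (Set.infinite_of_injective_forall_mem (f := fun n : ℕ => ((n, 0, 1) : ℕ × ℕ × ℕ))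
      (fun m n h => by simpa using h) fun n => IsCombVertex.tooth n 0)
  have hG : ComputableGraph (comb e) :=
    combGraph_adj_computablePred (hec.comp Computable.fst) (hec.comp Computable.snd)
  -- the distance function is computed with two queries to `f`
  have hu : Computable fun n : ℕ => e n.unpair.1 :=
    hec.comp (Computable.fst.comp Computable.unpair)
  have hv : Computable fun n : ℕ => e n.unpair.2 :=
    hec.comp (Computable.snd.comp Computable.unpair)
  let F : ℕ × ℕ × ℕ → ℕ := fun p =>
    combDist (hubDist p.2.1 (g (e p.1.unpair.1).1 0) (e p.1.unpair.1))
      (hubDist p.2.2 (g (e p.1.unpair.2).1 0) (e p.1.unpair.2)) (e p.1.unpair.1) (e p.1.unpair.2)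
  have hF : Computable F := by
    have hu' := hu.comp (Computable.fst (α := ℕ) (β := ℕ × ℕ))
    have hv' := hv.comp (Computable.fst (α := ℕ) (β := ℕ × ℕ))
    exact combDist_computable
      (hubDist_computable (Computable.fst.comp Computable.snd)
        (hgc.comp (Computable.fst.comp hu') (Computable.const 0)) hu')
      (hubDist_computable (Computable.snd.comp Computable.snd)
        (hgc.comp (Computable.fst.comp hv') (Computable.const 0)) hv') hu' hv'
  have hdist : ∀ n, distFun (comb e) n = F (n, f (e n.unpair.1).1, f (e n.unpair.2).1) :=
    fun n => comb_dist hfg hlim hinj he _ _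
  have hdf := turingReducible_of_two_queries (Computable.fst.comp hu) (Computable.fst.comp hv)
    hF hdist
  -- `f x` is read off from the distance of the hub to a vertex of the `x`-th tooth
  have hquery : ∀ H : SimpleGraph ℕ, ∀ i : comb e ≃g H, Computable i →
      ∃ b : ℕ → ℕ, Computable b ∧ ∀ x, f x = distFun H (b x) - 2 := by
    intro H i hi
    -- At this height the way through the root has length `g x 0 + 2`, at least the `f x + 2` of the
    -- way through the highest shortcut, so the minimum is always `f x + 2`.
    choose c hc using fun x => (he (x, g x 0 + 1, 1)).1 (.tooth _ _)
    obtain ⟨r, hr⟩ := (he (0, 0, 0)).1 .hub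
    have hcc : Computable c := by
      refine Computable.of_computablePred_graph (P := fun q => e q.2 = (q.1, g q.1 0 + 1, 1))
        (ComputablePred.eq (hec.comp Computable.snd) (Computable.fst.pair
          ((Computable.natAdd (hgc.comp Computable.fst (Computable.const 0))
            (Computable.const 1)).pair (Computable.const 1)))) fun x n => ?_
      rw [← hc x]
      exact hinj.eq_iff
    refine ⟨fun x => Nat.pair (i r) (i (c x)),
      Primrec₂.natPair.to_comp.comp (Computable.const _) (hi.comp hcc), fun x => ?_⟩
    have := hfg x 0
    simp only [distFun, Nat.unpair_pair, dist_iso, comb_dist hfg hlim hinj he, hr, hc, combDist,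
      hubDistOf, hubDist, true_or, if_true, one_ne_zero, if_false]
    omega
  have hcopy : ∀ H : SimpleGraph ℕ, ComputableGraph H → ∀ i : comb e ≃g H,
      FunOneEquiv (distFun H) (distFun (comb e)) ∧ BTTReducible 1 f (distFun H) ∧
        turingDeg (distFun H) = turingDeg f := by
    intro H hH i
    have hi := comb_iso_computable hg hec hinj he hH i
    have hle := funOneReducible_distFun i.symm (Computable.equiv_symm (h := i.toEquiv) hi)
    obtain ⟨b, hb, hfb⟩ := hquery H i hi
    have hsub : Computable fun n : ℕ => n - 2 :=
      Computable.natSub Computable.id (Computable.const 2)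
    refine ⟨⟨hle, funOneReducible_distFun i hi⟩, bttReducible_one hb hsub hfb,
      turingDeg_eq (hle.turingReducible.trans hdf)
        (turingReducible_of_two_queries (F := fun p => p.2.1 - 2) hb hb
          (hsub.comp (Computable.fst.comp Computable.snd)) hfb)⟩
  refine ⟨comb e, hG, comb_connected hlim hinj he, ?_, ?_⟩
  · ext d
    constructor
    · rintro ⟨H, hH, ⟨i⟩, rfl⟩
      exact (hcopy H hH i).2.2
    · rintro rfl
      exact ⟨comb e, hG, ⟨.refl⟩, (hcopy _ hG .refl).2.2.symm⟩
  · rintro H hH ⟨i⟩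
    exact ⟨(hcopy H hH i).1, bttReducible_two (Computable.fst.comp hu) (Computable.fst.comp hv)
      hF hdist, (hcopy H hH i).2.1⟩
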